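/- **Theorem 2 (Multi-Ring Modulation).** Fix a noise variance $N>0$. A circularly-symmetric complex Gaussian random variable with mean $0$ and variance $N$ has independent real and imaginary parts, each Gaussian with mean $0$ and variance $N/2$. Mutual information is measured in nats. (a) Let $\hat p>0$ be fixed. For every $P\ge\hat p$ there are positive integers $a=a(P)$ and $J=J(P)$ such that the following holds. Let $p_X$ be the law of $X=X_A e^{i\Phi}$, where $\Phi$ is uniform on $[0,2\pi)$, independent of $X_A$, and $X_A$ is uniformly distributed on the $J$ amplitudes $\sqrt{a j^2\hat p}$, $j=1,\dots,J$. Then $|X|^2\in\{m\hat p : m=1,2,3,\dots\}$ and $\mathbb E|X|^2\le P$. Moreover $a(P)/(N\log(P/N))\to 1$ as $P\to\infty$. For $Y=X+Z$, with $Z$ circularly-symmetric complex Gaussian of mean $0$ and variance $N$ and independent of $X$, the quantity $I(X;Y)$ is finite, the limit below exists, and $$\lim_{P\to\infty}\frac{I(X;Y)}{\log(P/N)}\ \ge\ 1 .$$ (b) Let $h_{11},h_{12},h_{21},h_{22}$ be real with $h_{12}\ne0$ and $h_{21}\ne 0$, and consider the memoryless two-user channel $$Y_k = X_k\, e^{\,i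 h_{k1}|X_1|^2+i h_{k2}|X_2|^2}+Z_k,\qquad k=1,2,$$ where $X_1,X_2,Z_1,Z_2$ are independent and $Z_1,Z_2$ are circularly-symmetric complex Gaussian of mean $0$ and variance $N$. Then for each $P$ there are laws of $X_1$ and $X_2$ with the following properties. Whenever $P\ge 2\pi/|h_{21}|$, the law of $X_1$ satisfies $\mathbb E|X_1|^2\le P$ and the interference focusing constraint that $h_{21}|X_1|^2$ is almost surely a nonzero integer multiple of $2\pi$. Whenever $P\ge 2\pi/|h_{12}|$, the law of $X_2$ satisfies $\mathbb E|X_2|^2\le P$ and the constraint that $h_{12}|X_2|^2$ is almost surely a nonzero integer multiple of $2\pi$. The rates $R_k(P,N)=I(X_k;Y_k)$ are finite for all large $P$, and $$\lim_{P\to\infty}\frac{R_k(P,N)}{\log(P/N)}=1,\qquad k=1,2 .$$ That is, interference focusing achieves the high-power pre-log pair $(1,1)$. -/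

import Mathlib

open MeasureTheory ProbabilityTheory Filter Topology
open scoped ENNReal

namespace Fiber

noncomputable section

/-- The mutual information `I(X;Y)` in nats of two random variables on `(Ω, Q)`: the
Kullback-Leibler divergence of the joint law from the product of the marginal laws. -/
def mutualInfo {Ω A B : Type*} [MeasurableSpace Ω] [MeasurableSpace A] [MeasurableSpace B]
    (Q : Measure Ω) (X : Ω → A) (Y : Ω → B) : ℝ≥0∞ :=
  InformationTheory.klDiv (Q.map fun ω => (X ω, Y ω)) ((Q.map X).prod (Q.map Y))

/-- The circularly-symmetric complex Gaussian law with mean `0` and variance `E|Z|² = N`: the real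
and imaginary parts are independent, each Gaussian with mean `0` and variance `N / 2`. -/
def complexGaussian (N : ℝ) : Measure ℂ :=
  ((gaussianReal 0 (N / 2).toNNReal).prod (gaussianReal 0 (N / 2).toNNReal)).map
    fun p => (⟨p.1, p.2⟩ : ℂ)

/-- `μ` is a probability distribution of a complex input `X` with `E|X|² ≤ P`. -/
structure IsInputLaw (P : ℝ) (μ : Measure ℂ) : Prop where
  isProbabilityMeasure : IsProbabilityMeasure μ
  integrable : Integrable (fun x : ℂ => ‖x‖ ^ 2) μ
  power_le : ∫ x : ℂ, ‖x‖ ^ 2 ∂μ ≤ P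

/-- The law of `r * exp (i Φ)`, with `Φ` uniformly distributed on `[0, 2π)`. -/
def ringLaw (r : ℝ) : Measure ℂ :=
  (cond (volume : Measure ℝ) (Set.Ico 0 (2 * Real.pi))).map
    fun φ : ℝ => (r : ℂ) * Complex.exp (Complex.I * (φ : ℂ))

/-- Multi-ring modulation: the phase is uniform and independent of the amplitude, and the amplitude
is uniform on `√(a j² p)`, `j = 1, …, J`. -/
def multiRingLaw (p : ℝ) (a J : ℕ) : Measure ℂ :=
  (J : ℝ≥0∞)⁻¹ • ∑ j ∈ Finset.Icc 1 J, ringLaw (Real.sqrt ((a : ℝ) * (j : ℝ) ^ 2 * p))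

/-- `I(X;Y)` for the channel `Y = X + Z`, where `X` has law `μ` and the noise `Z` is independent
of `X` and circularly-symmetric complex Gaussian with variance `N`. -/
def awgnInfo (N : ℝ) (μ : Measure ℂ) : ℝ≥0∞ :=
  mutualInfo (μ.prod (complexGaussian N)) (fun ω => ω.1) (fun ω => ω.1 + ω.2)

/-- The output `Y_k = X_k exp (i ∑ₗ h_{kℓ} |X_ℓ|²) + Z_k` of the memoryless two-user channel with
self-phase modulation (`h_{kk}`) and cross-phase modulation (`h_{kℓ}`, `k ≠ ℓ`). -/
def xpmOutput (h : Matrix (Fin 2) (Fin 2) ℝ) (k : Fin 2) (x z : Fin 2 → ℂ) : ℂ :=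
  x k * Complex.exp (Complex.I * ((∑ l, h k l * ‖x l‖ ^ 2 : ℝ) : ℂ)) + z k

/-- The information rate `I(X_k;Y_k)` of user `k` over the two-user channel, when the independent
inputs `X_ℓ` have the laws `μ ℓ`, and the noises at the two receivers are independent of each other
and of the inputs, each circularly-symmetric complex Gaussian with variance `N`. -/
def xpmRate (h : Matrix (Fin 2) (Fin 2) ℝ) (N : ℝ) (μ : Fin 2 → Measure ℂ) (k : Fin 2) : ℝ≥0∞ :=
  mutualInfo ((Measure.pi μ).prod (Measure.pi fun _ : Fin 2 => complexGaussian N))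
    (fun ω => ω.1 k) (fun ω => xpmOutput h k ω.1 ω.2)

/-- The interference focusing constraint on the input law of user `l`: the phase shift
`h_{kl} |X_l|²` that `l` causes at the other receiver `k` is almost surely a nonzero integer multiple
of `2π` (for `h_{kl} > 0` the multiples are automatically `1, 2, 3, …`). -/
def IsInterferenceFocused (h : Matrix (Fin 2) (Fin 2) ℝ) (l : Fin 2) (μ : Measure ℂ) : Prop :=
  ∀ k, k ≠ l → ∀ᵐ x ∂μ, ∃ n : ℤ, n ≠ 0 ∧ h k l * ‖x‖ ^ 2 = 2 * Real.pi * n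

/-- A scheme for the two-user channel at noise variance `N` assigns to each power `P` a pair of input
laws. It achieves the high-power pre-log pair `r` if, for all large `P`, the power constraints hold
and the rates are finite, and `R_k(P,N) / log (P/N)` tends to `r k` as `P → ∞`. -/
def AchievesHighPowerPreLog (h : Matrix (Fin 2) (Fin 2) ℝ) (N : ℝ) (μ : ℝ → Fin 2 → Measure ℂ)
    (r : Fin 2 → ℝ) : Prop :=
  ∀ k, (∀ᶠ P in atTop, IsInputLaw P (μ P k) ∧ xpmRate h N (μ P) k ≠ ∞) ∧
    Tendsto (fun P => (xpmRate h N (μ P) k).toReal / Real.log (P / N)) atTop (𝓝 (r k))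

end

end Fiber

/-!
The receiver sees `Y = T X + Z`, where `T` is the identity for the linear channel and, for the
two-user channel, the rotation `selfPhase` of `X` by a phase that depends on `|X|` only: interference
focusing makes the cross-phase a multiple of `2π`, so it disappears (`xpmRate_eq_channelInfo`). Both
parts are thus about `channelInfo N μ (selfPhase h)`, and `1` is the limit of its ratio to
`log (P/N)`.

*Upper bound* (`channelInfo_le`).  Replacing the output law by any other law can only increase the
divergence that defines the mutual information (`klDiv_prod_marginals_le`).  With a complex Gaussian
of variance `P + N` as replacement, the divergence is explicit and at most `log ((P + N)/N) + 2`.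

*Lower bound* (`le_channelInfo`).  The Donsker-Varadhan inequality
`∫ f dμ - log ∫ exp f dν ≤ KL(μ, ν)` with `f (x, y) = -|y - T x|² / (2N)` gives
`I(X;Y) ≥ -1/2 - log (2 E exp (-|T X' - T X|² / (4N)))` for an independent copy `X'` of `X`.  Hence
only the collision probability of the input at the scale of the noise matters, and no estimate of
the output density is needed.

*Collision estimate* (`exists_collision_bound`).  A Gaussian bump centred at `w` has mean at most a
constant times `exp (-c (|w| - r)² / 2) / r` over the circle of radius `r`, whatever `w` is
(`integral_ringLaw_exp_neg_le`).  For radii `j D`, `1 ≤ j ≤ J`, `D = √(a p)`, summing over pairs of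
rings leaves a convergent Gaussian sum times a harmonic sum, so the collision probability is
`O((1 + log J) / (J² D))`.  As `J² D² ≥ P / 4`, the information is at least
`log P - log (a p) / 2 - log (1 + log (P/p)) - O(1)`, and `a ~ N log (P/N)` makes all the
corrections `O(log log P)`.
-/

namespace Fiber

open InformationTheory

/-! ### Bounds for the Kullback-Leibler divergence and mutual information -/

/-- The Donsker-Varadhan lower bound: the excess of the left divergence is the divergence from the
measure `ν` tilted by `f`, which is nonnegative. -/
theorem integral_sub_log_integral_exp_le_klDiv {α : Type*} [MeasurableSpace α] {μ ν : Measure α}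
    [IsProbabilityMeasure μ] [IsProbabilityMeasure ν] (hfin : klDiv μ ν ≠ ∞) {f : α → ℝ}
    (hf : Integrable f μ) (hexp : Integrable (fun x => Real.exp (f x)) ν) :
    ∫ x, f x ∂μ - Real.log (∫ x, Real.exp (f x) ∂ν) ≤ (klDiv μ ν).toReal := by
  obtain ⟨hac, hint⟩ := klDiv_ne_top_iff.1 hfin
  have := isProbabilityMeasure_tilted hexp
  have hac' : μ ≪ ν.tilted f := hac.trans (absolutelyContinuous_tilted hexp)
  have h1 := toReal_klDiv_of_measure_eq hac' (by simp)
  have h2 := toReal_klDiv_of_measure_eq hac (by simp)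
  rw [integral_llr_tilted_right hac hf hexp hint] at h1
  have h3 : 0 ≤ (klDiv μ (ν.tilted f)).toReal := ENNReal.toReal_nonneg
  linarith

/-- Mutual information is at most the divergence from the product of the first marginal with an
arbitrary law `Q`: by the chain rule the difference is the divergence of the second marginal
from `Q`. -/
theorem klDiv_prod_marginals_le {A B : Type*} [MeasurableSpace A] [MeasurableSpace B]
    [StandardBorelSpace A] [Nonempty A]
    (ρ : Measure (A × B)) [IsProbabilityMeasure ρ] (Q : Measure B) [IsProbabilityMeasure Q] :
    klDiv ρ (ρ.fst.prod ρ.snd) ≤ klDiv ρ (ρ.fst.prod Q) := by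
  -- The chain rule splits off the first marginal, so the roles of the coordinates are exchanged.
  set σ : Measure (B × A) := ρ.map Prod.swap with hσ
  have : IsProbabilityMeasure σ := Measure.isProbabilityMeasure_map (by fun_prop)
  have hfst : σ.fst = ρ.snd := Measure.fst_map_swap
  have hdis : ρ.snd ⊗ₘ σ.condKernel = σ := by rw [← hfst]; exact σ.disintegrate _
  have hswap : ∀ R : Measure B, IsProbabilityMeasure R →
      (R ⊗ₘ Kernel.const B ρ.fst).map Prod.swap = ρ.fst.prod R := by
    intro R _
    rw [Measure.compProd_const, Measure.prod_swap]
  have hback : σ.map Prod.swap = ρ := by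
    rw [hσ, Measure.map_map (by fun_prop) (by fun_prop)]
    simp
  calc klDiv ρ (ρ.fst.prod ρ.snd)
      = klDiv (σ.map Prod.swap) ((ρ.snd ⊗ₘ Kernel.const B ρ.fst).map Prod.swap) := by
        rw [hback, hswap _ inferInstance]
    _ ≤ klDiv σ (ρ.snd ⊗ₘ Kernel.const B ρ.fst) := klDiv_map_le _ _ (by fun_prop)
    _ ≤ klDiv ρ.snd Q + klDiv σ (ρ.snd ⊗ₘ Kernel.const B ρ.fst) := le_add_self
    _ = klDiv σ (Q ⊗ₘ Kernel.const B ρ.fst) := by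
        have := klDiv_compProd_eq_add (μ := ρ.snd) (ν := Q) (κ := σ.condKernel)
          (η := Kernel.const B ρ.fst)
        rw [hdis] at this
        exact this.symm
    _ = klDiv (ρ.map Prod.swap) ((ρ.fst.prod Q).map Prod.swap) := by
        rw [Measure.compProd_const, Measure.prod_swap]
    _ ≤ klDiv ρ (ρ.fst.prod Q) := klDiv_map_le _ _ (by fun_prop)

theorem klDiv_withDensity_le {α : Type*} [MeasurableSpace α] {ν : Measure α}
    [IsProbabilityMeasure ν] {g : α → ℝ} (hg : Measurable g) (hpos : ∀ x, 0 < g x)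
    [IsProbabilityMeasure (ν.withDensity fun x => ENNReal.ofReal (g x))] {C : ℝ}
    (hint : Integrable (fun x => Real.log (g x)) (ν.withDensity fun x => ENNReal.ofReal (g x)))
    (hC : ∫ x, Real.log (g x) ∂(ν.withDensity fun x => ENNReal.ofReal (g x)) ≤ C) :
    klDiv (ν.withDensity fun x => ENNReal.ofReal (g x)) ν ≤ ENNReal.ofReal C := by
  set μ := ν.withDensity fun x => ENNReal.ofReal (g x) with hμ
  have hac : μ ≪ ν := withDensity_absolutelyContinuous _ _
  have hllr : llr μ ν =ᵐ[μ] fun x => Real.log (g x) := by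
    have := Measure.rnDeriv_withDensity ν (f := fun x => ENNReal.ofReal (g x)) (by fun_prop)
    filter_upwards [hac.ae_le this] with x hx
    simp only [llr, hμ, hx, ENNReal.toReal_ofReal (hpos x).le]
  rw [klDiv_of_ac_of_integrable hac ((integrable_congr hllr).2 hint), integral_congr_ae hllr]
  apply ENNReal.ofReal_le_ofReal
  simpa using hC

/-- Mutual information depends on the joint law only. -/
theorem mutualInfo_eq_klDiv_map {Ω A B : Type*} [MeasurableSpace Ω] [MeasurableSpace A]
    [MeasurableSpace B] (Q : Measure Ω) {X : Ω → A} {Y : Ω → B} (hX : Measurable X)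
    (hY : Measurable Y) :
    mutualInfo Q X Y = klDiv (Q.map fun ω => (X ω, Y ω))
      ((Q.map fun ω => (X ω, Y ω)).fst.prod (Q.map fun ω => (X ω, Y ω)).snd) := by
  rw [mutualInfo, Measure.fst_map_prodMk hY, Measure.snd_map_prodMk hX]

theorem integrable_exp_neg {α : Type*} [MeasurableSpace α] {ν : Measure α} [IsFiniteMeasure ν]
    {f : α → ℝ} (hf : Measurable f) (h0 : ∀ x, 0 ≤ f x) :
    Integrable (fun x => Real.exp (-f x)) ν := by
  refine Integrable.of_bound (by fun_prop) 1 (ae_of_all _ fun x => ?_)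
  rw [Real.norm_of_nonneg (Real.exp_pos _).le]
  exact Real.exp_le_one_iff.2 (neg_nonpos.2 (h0 x))

/-! ### The complex Gaussian law -/

/-- The density of `complexGaussian N` with respect to Lebesgue measure on `ℂ`. -/
noncomputable def gaussianDensity (N : ℝ) (z : ℂ) : ℝ :=
  (Real.pi * N)⁻¹ * Real.exp (-‖z‖ ^ 2 / N)

@[fun_prop]
theorem measurable_gaussianDensity (N : ℝ) : Measurable (gaussianDensity N) := by
  unfold gaussianDensity; fun_prop

theorem gaussianDensity_pos {N : ℝ} (hN : 0 < N) (z : ℂ) : 0 < gaussianDensity N z := by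
  unfold gaussianDensity; positivity

theorem measurable_complexMk : Measurable fun p : ℝ × ℝ => (⟨p.1, p.2⟩ : ℂ) :=
  Complex.measurableEquivRealProd.symm.measurable

instance isProbabilityMeasure_complexGaussian (N : ℝ) :
    IsProbabilityMeasure (complexGaussian N) :=
  Measure.isProbabilityMeasure_map measurable_complexMk.aemeasurable

theorem complexGaussian_eq_withDensity {N : ℝ} (hN : 0 < N) :
    complexGaussian N = volume.withDensity fun z => ENNReal.ofReal (gaussianDensity N z) := by
  have hv : (N / 2).toNNReal ≠ 0 := by simpa using hN
  have hpdf : ∀ z : ℂ, gaussianPDF 0 (N / 2).toNNReal z.re * gaussianPDF 0 (N / 2).toNNReal z.im =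
      ENNReal.ofReal (gaussianDensity N z) := by
    intro z
    rw [gaussianPDF, gaussianPDF, ← ENNReal.ofReal_mul (gaussianPDFReal_nonneg _ _ _)]
    congr 1
    have hc : (((N / 2).toNNReal : NNReal) : ℝ) = N / 2 := Real.coe_toNNReal _ (by positivity)
    rw [gaussianPDFReal, gaussianPDFReal, hc, gaussianDensity, mul_mul_mul_comm, ← mul_inv,
      Real.mul_self_sqrt (by positivity), ← Real.exp_add, Complex.sq_norm, Complex.normSq_apply]
    congr 2
    · ring
    · ring
  refine Measure.ext_of_lintegral _ fun f hf => ?_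
  rw [complexGaussian, lintegral_map hf measurable_complexMk, gaussianReal_of_var_ne_zero _ hv,
    prod_withDensity (measurable_gaussianPDF _ _) (measurable_gaussianPDF _ _),
    lintegral_withDensity_eq_lintegral_mul _ (by fun_prop) hf]
  refine (lintegral_withDensity_eq_lintegral_mul _ (by fun_prop)
    (hf.comp measurable_complexMk)).trans ?_
  rw [← (Complex.volume_preserving_equiv_real_prod.symm).lintegral_comp_emb
    Complex.measurableEquivRealProd.symm.measurableEmbedding]
  refine lintegral_congr fun p => ?_
  simp only [Pi.mul_apply]
  rw [← hpdf]
  rfl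

theorem integrable_sq_norm_complexGaussian (N : ℝ) :
    Integrable (fun z : ℂ => ‖z‖ ^ 2) (complexGaussian N) := by
  rw [complexGaussian, integrable_map_measure (by fun_prop) measurable_complexMk.aemeasurable]
  have h : Integrable (fun x : ℝ => x ^ 2) (gaussianReal 0 (N / 2).toNNReal) :=
    (memLp_id_gaussianReal 2).integrable_sq
  refine ((h.comp_fst _).add (h.comp_snd _)).congr (ae_of_all _ fun p => ?_)
  simp [Complex.sq_norm, Complex.normSq_apply, ← sq]

theorem integral_sq_norm_complexGaussian {N : ℝ} (hN : 0 < N) :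
    ∫ z : ℂ, ‖z‖ ^ 2 ∂(complexGaussian N) = N := by
  rw [complexGaussian, integral_map measurable_complexMk.aemeasurable (by fun_prop)]
  have h : Integrable (fun x : ℝ => x ^ 2) (gaussianReal 0 (N / 2).toNNReal) :=
    (memLp_id_gaussianReal 2).integrable_sq
  have hvar : ∫ x, x ^ 2 ∂(gaussianReal 0 (N / 2).toNNReal) = N / 2 := by
    have h1 := variance_id_gaussianReal (μ := 0) (v := (N / 2).toNNReal)
    rw [variance_eq_integral (by fun_prop)] at h1
    simpa [Real.coe_toNNReal _ (by positivity : 0 ≤ N / 2)] using h1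
  have : ∀ p : ℝ × ℝ, ‖(⟨p.1, p.2⟩ : ℂ)‖ ^ 2 = p.1 ^ 2 + p.2 ^ 2 := by
    intro p; simp [Complex.sq_norm, Complex.normSq_apply, ← sq]
  simp_rw [this]
  rw [integral_add (h.comp_fst _) (h.comp_snd _), integral_fun_fst (fun x : ℝ => x ^ 2),
    integral_fun_snd (fun x : ℝ => x ^ 2), hvar]
  simp

theorem lintegral_exp_sq_norm_complexGaussian {N : ℝ} (hN : 0 < N) :
    ∫⁻ z : ℂ, ENNReal.ofReal (Real.exp (‖z‖ ^ 2 / (2 * N))) ∂(complexGaussian N) = 2 := by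
  have h1 : ∫⁻ z : ℂ, ENNReal.ofReal (gaussianDensity (2 * N) z) = 1 := by
    have := measure_univ (μ := complexGaussian (2 * N))
    rwa [complexGaussian_eq_withDensity (by positivity), withDensity_apply _ .univ,
      setLIntegral_univ] at this
  rw [complexGaussian_eq_withDensity hN,
    lintegral_withDensity_eq_lintegral_mul _ (by fun_prop) (by fun_prop)]
  have h2 : ∀ z : ℂ, ENNReal.ofReal (gaussianDensity N z) *
      ENNReal.ofReal (Real.exp (‖z‖ ^ 2 / (2 * N))) =
      2 * ENNReal.ofReal (gaussianDensity (2 * N) z) := by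
    intro z
    rw [← ENNReal.ofReal_mul (gaussianDensity_pos hN z).le,
      show (2 : ℝ≥0∞) = ENNReal.ofReal 2 by simp, ← ENNReal.ofReal_mul (by norm_num)]
    congr 1
    have he : -‖z‖ ^ 2 / N + ‖z‖ ^ 2 / (2 * N) = -‖z‖ ^ 2 / (2 * N) := by
      field_simp
      ring
    rw [gaussianDensity, gaussianDensity, mul_assoc, ← Real.exp_add, he]
    field_simp
  simp_rw [Pi.mul_apply, h2]
  rw [lintegral_const_mul _ (by fun_prop), h1, mul_one]

theorem integrable_exp_sq_norm_complexGaussian {N : ℝ} (hN : 0 < N) :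
    Integrable (fun z : ℂ => Real.exp (‖z‖ ^ 2 / (2 * N))) (complexGaussian N) := by
  refine (lintegral_ofReal_ne_top_iff_integrable (by fun_prop)
    (ae_of_all _ fun z => (Real.exp_pos _).le)).1 ?_
  rw [lintegral_exp_sq_norm_complexGaussian hN]
  simp

theorem integral_exp_sq_norm_complexGaussian {N : ℝ} (hN : 0 < N) :
    ∫ z : ℂ, Real.exp (‖z‖ ^ 2 / (2 * N)) ∂(complexGaussian N) = 2 := by
  rw [integral_eq_lintegral_of_nonneg_ae (ae_of_all _ fun z => (Real.exp_pos _).le) (by fun_prop),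
    lintegral_exp_sq_norm_complexGaussian hN]
  simp

/-! ### A memoryless channel with additive Gaussian noise -/

section channel

/-- The joint law of `(X, T X + Z)`, where `X` has law `μ` and `Z` is an independent complex
Gaussian of variance `N`. -/
noncomputable def channelLaw (N : ℝ) (μ : Measure ℂ) (T : ℂ → ℂ) : Measure (ℂ × ℂ) :=
  (μ.prod (complexGaussian N)).map fun p => (p.1, T p.1 + p.2)

/-- The mutual information `I(X; T X + Z)`, as a function of the joint law. -/
noncomputable def channelInfo (N : ℝ) (μ : Measure ℂ) (T : ℂ → ℂ) : ℝ≥0∞ :=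
  klDiv (channelLaw N μ T)
    ((channelLaw N μ T).fst.prod (channelLaw N μ T).snd)

variable {N : ℝ} {μ : Measure ℂ} {T : ℂ → ℂ}

theorem isProbabilityMeasure_channelLaw [IsProbabilityMeasure μ] (hT : Measurable T) :
    IsProbabilityMeasure (channelLaw N μ T) :=
  Measure.isProbabilityMeasure_map (by fun_prop)

theorem fst_channelLaw (hT : Measurable T) : (channelLaw N μ T).fst = μ := by
  rw [channelLaw, Measure.fst_map_prodMk (by fun_prop)]
  exact Measure.fst_prod

theorem snd_channelLaw :
    (channelLaw N μ T).snd = (μ.prod (complexGaussian N)).map fun p => T p.1 + p.2 := by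
  rw [channelLaw, Measure.snd_map_prodMk (by fun_prop)]

theorem channelLaw_eq_withDensity [SFinite μ] (hN : 0 < N) {σ : ℝ} (hσ : 0 < σ)
    (hT : Measurable T) :
    channelLaw N μ T = (μ.prod (complexGaussian σ)).withDensity fun p =>
      ENNReal.ofReal (gaussianDensity N (p.2 - T p.1) / gaussianDensity σ p.2) := by
  refine Measure.ext_of_lintegral _ fun f hf => ?_
  rw [channelLaw, lintegral_map hf (by fun_prop), lintegral_prod _ (by fun_prop),
    lintegral_withDensity_eq_lintegral_mul _ (by fun_prop) hf, lintegral_prod _ (by fun_prop)]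
  refine lintegral_congr fun x => ?_
  rw [complexGaussian_eq_withDensity hN, complexGaussian_eq_withDensity hσ,
    lintegral_withDensity_eq_lintegral_mul _ (by fun_prop) (by fun_prop),
    lintegral_withDensity_eq_lintegral_mul _ (by fun_prop) (by fun_prop)]
  refine Eq.trans ?_ (lintegral_add_left_eq_self _ (T x))
  refine lintegral_congr fun z => ?_
  simp only [Pi.mul_apply, add_sub_cancel_left]
  rw [← mul_assoc, ← ENNReal.ofReal_mul (gaussianDensity_pos hσ _).le,
    mul_div_cancel₀ _ (gaussianDensity_pos hσ _).ne']

/-- The upper bound by the capacity of the Gaussian channel, up to the constant `2`, which comes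
from the crude estimate `|T x + z|² ≤ 2 |x|² + 2 |z|²` in place of an exact second moment. -/
theorem channelInfo_le [IsProbabilityMeasure μ] (hN : 0 < N) (hT : Measurable T)
    (hnorm : ∀ x, ‖T x‖ = ‖x‖) {P : ℝ}
    (hμ : IsInputLaw P μ) :
    channelInfo N μ T ≤ ENNReal.ofReal (Real.log ((P + N) / N) + 2) := by
  have hP : 0 ≤ P := (integral_nonneg fun _ => by positivity).trans hμ.power_le
  set σ := P + N with hσdef
  have hσ : 0 < σ := by positivity
  have := isProbabilityMeasure_channelLaw (N := N) (μ := μ) hT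
  refine (klDiv_prod_marginals_le _ (complexGaussian σ)).trans ?_
  rw [fst_channelLaw hT]
  have hden := channelLaw_eq_withDensity (μ := μ) hN hσ hT
  set g : ℂ × ℂ → ℝ := fun p => gaussianDensity N (p.2 - T p.1) / gaussianDensity σ p.2 with hg
  have hgm : Measurable g := by fun_prop
  have hlogm : Measurable fun p => Real.log (g p) := Real.measurable_log.comp hgm
  have hlog : ∀ p, Real.log (g p) =
      Real.log (σ / N) + (‖p.2‖ ^ 2 / σ - ‖p.2 - T p.1‖ ^ 2 / N) := by
    intro p
    have : g p = σ / N * Real.exp (‖p.2‖ ^ 2 / σ - ‖p.2 - T p.1‖ ^ 2 / N) := by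
      simp only [hg, gaussianDensity]
      rw [mul_div_mul_comm, ← Real.exp_sub]
      congr 1
      · field_simp
      · ring_nf
    rw [this, Real.log_mul (by positivity) (Real.exp_pos _).ne', Real.log_exp]
  have hx : Integrable (fun p : ℂ × ℂ => ‖p.1‖ ^ 2) (μ.prod (complexGaussian N)) :=
    hμ.integrable.comp_fst _
  have hz : Integrable (fun p : ℂ × ℂ => ‖p.2‖ ^ 2) (μ.prod (complexGaussian N)) :=
    (integrable_sq_norm_complexGaussian N).comp_snd _
  have hbound : ∀ p : ℂ × ℂ, ‖T p.1 + p.2‖ ^ 2 ≤ 2 * ‖p.1‖ ^ 2 + 2 * ‖p.2‖ ^ 2 := by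
    intro p
    have h1 := norm_add_le (T p.1) p.2
    rw [hnorm] at h1
    have h2 := norm_nonneg (T p.1 + p.2)
    nlinarith [sq_nonneg (‖p.1‖ - ‖p.2‖)]
  have hy : Integrable (fun p : ℂ × ℂ => ‖T p.1 + p.2‖ ^ 2) (μ.prod (complexGaussian N)) := by
    refine ((hx.const_mul 2).add (hz.const_mul 2)).mono' (by fun_prop) (ae_of_all _ fun p => ?_)
    rw [Real.norm_of_nonneg (by positivity)]
    exact hbound p
  have hcomp : ∀ p : ℂ × ℂ, Real.log (g (p.1, T p.1 + p.2)) =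
      Real.log (σ / N) + (‖T p.1 + p.2‖ ^ 2 / σ - ‖p.2‖ ^ 2 / N) := by
    intro p; rw [hlog]; simp
  have hint' : Integrable (fun p : ℂ × ℂ => Real.log (g (p.1, T p.1 + p.2)))
      (μ.prod (complexGaussian N)) := by
    simp_rw [hcomp]
    exact (integrable_const _).add ((hy.div_const _).sub (hz.div_const _))
  have hint : Integrable (fun p => Real.log (g p)) (channelLaw N μ T) :=
    (integrable_map_measure hlogm.aestronglyMeasurable (by fun_prop)).2 hint'
  have hC : ∫ p, Real.log (g p) ∂(channelLaw N μ T) ≤ Real.log (σ / N) + 2 := by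
    rw [channelLaw, integral_map (by fun_prop) hlogm.aestronglyMeasurable]
    calc ∫ p : ℂ × ℂ, Real.log (g (p.1, T p.1 + p.2)) ∂(μ.prod (complexGaussian N))
        ≤ ∫ p : ℂ × ℂ, (Real.log (σ / N) + (2 / σ * ‖p.1‖ ^ 2 + 2 / σ * ‖p.2‖ ^ 2))
            ∂(μ.prod (complexGaussian N)) := by
          refine integral_mono hint'
            ((integrable_const _).add ((hx.const_mul _).add (hz.const_mul _))) fun p => ?_
          simp only [hcomp]
          have h1 : ‖T p.1 + p.2‖ ^ 2 / σ ≤ (2 * ‖p.1‖ ^ 2 + 2 * ‖p.2‖ ^ 2) / σ := by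
            gcongr
            exact hbound p
          have h2 : 0 ≤ ‖p.2‖ ^ 2 / N := by positivity
          have h3 : (2 * ‖p.1‖ ^ 2 + 2 * ‖p.2‖ ^ 2) / σ =
            2 / σ * ‖p.1‖ ^ 2 + 2 / σ * ‖p.2‖ ^ 2 := by ring
          linarith
      _ = Real.log (σ / N) + (2 / σ * (∫ x, ‖x‖ ^ 2 ∂μ) + 2 / σ * N) := by
          rw [integral_add (integrable_const _) (by exact (hx.const_mul _).add (hz.const_mul _)),
            integral_add (hx.const_mul _) (hz.const_mul _), integral_const_mul, integral_const_mul,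
            integral_fun_fst (fun x : ℂ => ‖x‖ ^ 2), integral_fun_snd (fun x : ℂ => ‖x‖ ^ 2),
            integral_sq_norm_complexGaussian hN]
          simp
      _ ≤ Real.log (σ / N) + 2 := by
          have h1 : 2 / σ * (∫ x, ‖x‖ ^ 2 ∂μ) ≤ 2 / σ * P := by
            gcongr
            exact hμ.power_le
          have h2 : 2 / σ * P + 2 / σ * N = 2 := by
            rw [← mul_add, ← hσdef]; field_simp
          linarith
  rw [hden] at hint hC this ⊢
  exact klDiv_withDensity_le hgm
    (fun p => div_pos (gaussianDensity_pos hN _) (gaussianDensity_pos hσ _)) hint hC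

/-- Under the product of the marginals, the bump `exp (-|y - T x|² / (2N))` has mean at most twice
the collision integral of the input: with `y = T x' + z` and
`|T x' - T x|² ≤ 2 |y - T x|² + 2 |z|²`, the noise splits off as the factor
`E exp (|Z|² / (2N)) = 2`. -/
theorem integral_exp_neg_sq_dist_output_le [IsProbabilityMeasure μ] (hN : 0 < N)
    (hT : Measurable T) :
    ∫ q : ℂ × ℂ, Real.exp (-(‖q.2 - T q.1‖ ^ 2 / (2 * N)))
        ∂((channelLaw N μ T).fst.prod (channelLaw N μ T).snd) ≤
      2 * ∫ x', ∫ x, Real.exp (-(‖T x' - T x‖ ^ 2 / (4 * N))) ∂μ ∂μ := by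
  have := isProbabilityMeasure_channelLaw (N := N) (μ := μ) hT
  have hF : Integrable (fun x' => ∫ x, Real.exp (-(‖T x' - T x‖ ^ 2 / (4 * N))) ∂μ) μ :=
    (integrable_exp_neg (ν := μ.prod μ) (f := fun q => ‖T q.1 - T q.2‖ ^ 2 / (4 * N))
      (by fun_prop) fun q => by positivity).integral_prod_left
  rw [integral_prod_symm _ (integrable_exp_neg (by fun_prop) fun q => by positivity),
    fst_channelLaw hT, snd_channelLaw]
  have hm : StronglyMeasurable fun y : ℂ => ∫ x, Real.exp (-(‖y - T x‖ ^ 2 / (2 * N))) ∂μ :=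
    StronglyMeasurable.integral_prod_right'
      (f := fun q : ℂ × ℂ => Real.exp (-(‖q.1 - T q.2‖ ^ 2 / (2 * N))))
      (Measurable.stronglyMeasurable (by fun_prop))
  rw [integral_map (by fun_prop) hm.aestronglyMeasurable]
  have hprod : ∫ p : ℂ × ℂ, (∫ x, Real.exp (-(‖T p.1 - T x‖ ^ 2 / (4 * N))) ∂μ) *
      Real.exp (‖p.2‖ ^ 2 / (2 * N)) ∂(μ.prod (complexGaussian N)) =
      2 * ∫ x', ∫ x, Real.exp (-(‖T x' - T x‖ ^ 2 / (4 * N))) ∂μ ∂μ := by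
    rw [integral_prod_mul (fun x' => ∫ x, Real.exp (-(‖T x' - T x‖ ^ 2 / (4 * N))) ∂μ)
      (fun z : ℂ => Real.exp (‖z‖ ^ 2 / (2 * N))), integral_exp_sq_norm_complexGaussian hN,
      mul_comm]
  rw [← hprod]
  refine integral_mono_of_nonneg (ae_of_all _ fun p => integral_nonneg fun _ => (Real.exp_pos _).le)
    (hF.mul_prod (integrable_exp_sq_norm_complexGaussian hN)) (ae_of_all _ fun p => ?_)
  simp only
  rw [← integral_mul_const]
  refine integral_mono (integrable_exp_neg (by fun_prop) fun x => by positivity)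
    ((integrable_exp_neg (by fun_prop) fun x => by positivity).mul_const _) fun x => ?_
  rw [← Real.exp_add, Real.exp_le_exp]
  have h1 : ‖T p.1 - T x‖ ≤ ‖T p.1 + p.2 - T x‖ + ‖p.2‖ := by
    have := norm_sub_le (T p.1 + p.2 - T x) p.2
    rwa [show T p.1 + p.2 - T x - p.2 = T p.1 - T x by ring] at this
  have h2 : ‖T p.1 - T x‖ ^ 2 ≤ 2 * ‖T p.1 + p.2 - T x‖ ^ 2 + 2 * ‖p.2‖ ^ 2 := by
    nlinarith [norm_nonneg (T p.1 - T x), sq_nonneg (‖T p.1 + p.2 - T x‖ - ‖p.2‖)]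
  have h3 : ‖T p.1 - T x‖ ^ 2 / (4 * N) ≤
      (2 * ‖T p.1 + p.2 - T x‖ ^ 2 + 2 * ‖p.2‖ ^ 2) / (4 * N) := by gcongr
  have h4 : (2 * ‖T p.1 + p.2 - T x‖ ^ 2 + 2 * ‖p.2‖ ^ 2) / (4 * N) =
      ‖T p.1 + p.2 - T x‖ ^ 2 / (2 * N) + ‖p.2‖ ^ 2 / (2 * N) := by field_simp; ring
  linarith

/-- The lower bound for the information in terms of the collision integral of the input, from the
Donsker-Varadhan inequality with `f (x, y) = -|y - T x|² / (2N)`. -/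
theorem le_channelInfo [IsProbabilityMeasure μ] (hN : 0 < N) (hT : Measurable T)
    (hfin : channelInfo N μ T ≠ ∞) {B : ℝ}
    (hB : ∫ x', ∫ x, Real.exp (-(‖T x' - T x‖ ^ 2 / (4 * N))) ∂μ ∂μ ≤ B) :
    -(1 / 2) - Real.log (2 * B) ≤ (channelInfo N μ T).toReal := by
  have := isProbabilityMeasure_channelLaw (N := N) (μ := μ) hT
  have hz : Integrable (fun p : ℂ × ℂ => ‖p.2‖ ^ 2) (μ.prod (complexGaussian N)) :=
    (integrable_sq_norm_complexGaussian N).comp_snd _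
  have hcomp : ∀ p : ℂ × ℂ, -(‖T p.1 + p.2 - T p.1‖ ^ 2 / (2 * N)) = -(‖p.2‖ ^ 2 / (2 * N)) := by
    intro p; simp
  have hint : Integrable (fun q : ℂ × ℂ => -(‖q.2 - T q.1‖ ^ 2 / (2 * N))) (channelLaw N μ T) := by
    rw [channelLaw, integrable_map_measure (by fun_prop) (by fun_prop)]
    simp only [Function.comp_def, hcomp]
    exact (hz.div_const _).neg
  have hval : ∫ q : ℂ × ℂ, -(‖q.2 - T q.1‖ ^ 2 / (2 * N)) ∂(channelLaw N μ T) = -(1 / 2) := by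
    rw [channelLaw, integral_map (by fun_prop) (by fun_prop)]
    simp only [hcomp]
    rw [integral_neg, integral_div, integral_fun_snd (fun z : ℂ => ‖z‖ ^ 2),
      integral_sq_norm_complexGaussian hN]
    simp
    field_simp
  have hexp : Integrable (fun q : ℂ × ℂ => Real.exp (-(‖q.2 - T q.1‖ ^ 2 / (2 * N))))
      ((channelLaw N μ T).fst.prod (channelLaw N μ T).snd) :=
    integrable_exp_neg (by fun_prop) fun q => by positivity
  have hdv := integral_sub_log_integral_exp_le_klDiv hfin hint hexp
  rw [hval] at hdv
  have hlog := Real.log_le_log (integral_exp_pos hexp)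
    ((integral_exp_neg_sq_dist_output_le hN hT).trans (mul_le_mul_of_nonneg_left hB zero_le_two))
  exact (sub_le_sub_left hlog _).trans hdv

end channel

/-! ### Self-phase modulation and the reduction of the two-user channel -/

/-- The self-phase modulation `x ↦ x exp (i h |x|²)`; `h = 0` gives the identity. -/
noncomputable def selfPhase (h : ℝ) (x : ℂ) : ℂ :=
  x * Complex.exp (Complex.I * ((h * ‖x‖ ^ 2 : ℝ) : ℂ))

@[fun_prop]
theorem measurable_selfPhase (h : ℝ) : Measurable (selfPhase h) := by
  unfold selfPhase; fun_prop

theorem norm_selfPhase (h : ℝ) (x : ℂ) : ‖selfPhase h x‖ = ‖x‖ := by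
  rw [selfPhase, norm_mul, mul_comm Complex.I, Complex.norm_exp_ofReal_mul_I, mul_one]

theorem awgnInfo_eq_channelInfo (N : ℝ) (μ : Measure ℂ) :
    awgnInfo N μ = channelInfo N μ (selfPhase 0) := by
  rw [awgnInfo, mutualInfo_eq_klDiv_map _ (by fun_prop) (by fun_prop), channelInfo, channelLaw]
  simp [selfPhase]

theorem measurable_xpmOutput (h : Matrix (Fin 2) (Fin 2) ℝ) (k : Fin 2) :
    Measurable fun ω : (Fin 2 → ℂ) × (Fin 2 → ℂ) => xpmOutput h k ω.1 ω.2 := by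
  unfold xpmOutput; fun_prop

theorem xpmOutput_eq_of_focused {h : Matrix (Fin 2) (Fin 2) ℝ} {k l : Fin 2} (hkl : k ≠ l)
    {x z : Fin 2 → ℂ} {n : ℤ} (hn : h k l * ‖x l‖ ^ 2 = 2 * Real.pi * n) :
    xpmOutput h k x z = selfPhase (h k k) (x k) + z k := by
  rw [xpmOutput, selfPhase, Fintype.sum_eq_add k l hkl (fun i hi => by omega), hn]
  congr 2
  rw [Complex.ofReal_add, mul_add, Complex.exp_add,
    show Complex.I * ((2 * Real.pi * n : ℝ) : ℂ) = n * (2 * Real.pi * Complex.I) by push_cast; ring,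
    Complex.exp_int_mul_two_pi_mul_I, mul_one]

theorem xpmRate_eq_channelInfo (h : Matrix (Fin 2) (Fin 2) ℝ) (N : ℝ) (μ : Fin 2 → Measure ℂ)
    [∀ l, IsProbabilityMeasure (μ l)] {k l : Fin 2} (hkl : k ≠ l)
    (hfoc : IsInterferenceFocused h l (μ l)) :
    xpmRate h N μ k = channelInfo N (μ k) (selfPhase (h k k)) := by
  have hlaw : ((Measure.pi μ).prod (Measure.pi fun _ : Fin 2 => complexGaussian N)).map
      (fun ω => (ω.1 k, xpmOutput h k ω.1 ω.2)) = channelLaw N (μ k) (selfPhase (h k k)) := by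
    have hae : ∀ᵐ ω ∂((Measure.pi μ).prod (Measure.pi fun _ : Fin 2 => complexGaussian N)),
        (ω.1 k, xpmOutput h k ω.1 ω.2) = (ω.1 k, selfPhase (h k k) (ω.1 k) + ω.2 k) := by
      have h1 := (measurePreserving_eval μ l).quasiMeasurePreserving.ae (hfoc k hkl)
      have h2 := (Measure.quasiMeasurePreserving_fst (μ := Measure.pi μ)
        (ν := Measure.pi fun _ : Fin 2 => complexGaussian N)).ae h1
      filter_upwards [h2] with ω ⟨n, _, hn⟩
      rw [xpmOutput_eq_of_focused hkl hn]
    rw [Measure.map_congr hae, channelLaw]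
    have hmp := (measurePreserving_eval μ k).prod
      (measurePreserving_eval (fun _ : Fin 2 => complexGaussian N) k)
    rw [← hmp.map_eq, Measure.map_map (by fun_prop) hmp.measurable]
    rfl
  rw [xpmRate, mutualInfo_eq_klDiv_map _ (by fun_prop) (measurable_xpmOutput h k), hlaw,
    channelInfo]

/-! ### The uniform law on a circle -/

theorem volume_Ico_zero_two_pi :
    (volume : Measure ℝ) (Set.Ico 0 (2 * Real.pi)) = ENNReal.ofReal (2 * Real.pi) := by
  simp

instance isProbabilityMeasure_ringLaw (r : ℝ) : IsProbabilityMeasure (ringLaw r) := by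
  have : IsProbabilityMeasure (cond (volume : Measure ℝ) (Set.Ico 0 (2 * Real.pi))) :=
    cond_isProbabilityMeasure_of_finite
      (by rw [volume_Ico_zero_two_pi]; simp [Real.pi_pos])
      (by rw [volume_Ico_zero_two_pi]; exact ENNReal.ofReal_ne_top)
  exact Measure.isProbabilityMeasure_map (by fun_prop)

theorem norm_mul_exp_I {r : ℝ} (hr : 0 ≤ r) (φ : ℝ) :
    ‖(r : ℂ) * Complex.exp (Complex.I * (φ : ℂ))‖ = r := by
  rw [norm_mul, mul_comm Complex.I, Complex.norm_exp_ofReal_mul_I, mul_one, Complex.norm_real,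
    Real.norm_of_nonneg hr]

theorem ae_norm_eq_ringLaw {r : ℝ} (hr : 0 ≤ r) : ∀ᵐ x ∂(ringLaw r), ‖x‖ = r :=
  (ae_map_iff (by fun_prop) (measurableSet_eq_fun (by fun_prop) (by fun_prop))).2
    (ae_of_all _ fun φ => norm_mul_exp_I hr φ)

theorem integral_ringLaw (r : ℝ) {f : ℂ → ℝ} (hf : Measurable f) :
    ∫ x, f x ∂(ringLaw r) = (2 * Real.pi)⁻¹ *
      ∫ φ in (0 : ℝ)..(2 * Real.pi), f (r * Complex.exp (Complex.I * (φ : ℂ))) := by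
  rw [ringLaw, integral_map (by fun_prop) hf.aestronglyMeasurable, ProbabilityTheory.cond,
    integral_smul_measure, intervalIntegral.integral_of_le Real.two_pi_pos.le,
    integral_Ico_eq_integral_Ioc, volume_Ico_zero_two_pi, ENNReal.toReal_inv,
    ENNReal.toReal_ofReal Real.two_pi_pos.le, smul_eq_mul]

/-- The integrand has period `π` and, by Jordan's inequality, is dominated by a Gaussian on
`[-π/2, π/2]`. -/
theorem integral_exp_neg_sin_sq_le {b : ℝ} (hb : 0 < b) (β : ℝ) :
    ∫ φ in (0 : ℝ)..(2 * Real.pi), Real.exp (-(b * Real.sin (φ + β) ^ 2)) ≤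
      2 * √(Real.pi / (b * (2 / Real.pi) ^ 2)) := by
  set g : ℝ → ℝ := fun φ => Real.exp (-(b * Real.sin φ ^ 2)) with hg
  have hgc : Continuous g := by fun_prop
  have hper : Function.Periodic g Real.pi := by
    intro φ; simp [hg, Real.sin_add_pi]
  have hhalf : ∫ φ in (-(Real.pi / 2))..(-(Real.pi / 2) + Real.pi), g φ ≤
      √(Real.pi / (b * (2 / Real.pi) ^ 2)) := by
    have hb' : 0 < b * (2 / Real.pi) ^ 2 := by positivity
    have hint := integrable_exp_neg_mul_sq hb'
    have hle : -(Real.pi / 2) ≤ -(Real.pi / 2) + Real.pi := by linarith [Real.pi_pos]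
    calc ∫ φ in (-(Real.pi / 2))..(-(Real.pi / 2) + Real.pi), g φ
        ≤ ∫ φ in (-(Real.pi / 2))..(-(Real.pi / 2) + Real.pi),
            Real.exp (-(b * (2 / Real.pi) ^ 2) * φ ^ 2) := by
          refine intervalIntegral.integral_mono_on hle (hgc.intervalIntegrable _ _)
            (Continuous.intervalIntegrable (by fun_prop) _ _) fun φ hφ => ?_
          have h1 : |φ| ≤ Real.pi / 2 := abs_le.2 ⟨hφ.1, by linarith [hφ.2]⟩
          have h2 := Real.mul_abs_le_abs_sin h1
          have h3 : (2 / Real.pi * |φ|) ^ 2 ≤ |Real.sin φ| ^ 2 :=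
            pow_le_pow_left₀ (by positivity) h2 2
          rw [mul_pow, sq_abs, sq_abs] at h3
          rw [hg, Real.exp_le_exp, neg_mul, neg_le_neg_iff, mul_assoc]
          exact mul_le_mul_of_nonneg_left h3 hb.le
      _ ≤ ∫ φ, Real.exp (-(b * (2 / Real.pi) ^ 2) * φ ^ 2) := by
          rw [intervalIntegral.integral_of_le hle]
          exact setIntegral_le_integral hint (ae_of_all _ fun _ => (Real.exp_pos _).le)
      _ = _ := integral_gaussian _
  calc ∫ φ in (0 : ℝ)..(2 * Real.pi), Real.exp (-(b * Real.sin (φ + β) ^ 2))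
      = ∫ φ in β..(β + Real.pi + Real.pi), g φ := by
        rw [intervalIntegral.integral_comp_add_right g β]
        congr 1 <;> ring
    _ = (∫ φ in β..(β + Real.pi), g φ) + ∫ φ in (β + Real.pi)..(β + Real.pi + Real.pi), g φ :=
        (intervalIntegral.integral_add_adjacent_intervals (hgc.intervalIntegrable _ _)
          (hgc.intervalIntegrable _ _)).symm
    _ = 2 * ∫ φ in (-(Real.pi / 2))..(-(Real.pi / 2) + Real.pi), g φ := by
        rw [hper.intervalIntegral_add_eq β (-(Real.pi / 2)),
          hper.intervalIntegral_add_eq (β + Real.pi) (-(Real.pi / 2)), two_mul]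
    _ ≤ _ := by linarith

/-- The distance from `w` to a point of the circle of radius `r` is at least the distance from that
point to the line through `0` and `w`. -/
theorem sq_mul_sin_sq_le_sq_norm_sub (w : ℂ) (r ψ : ℝ) :
    r ^ 2 * Real.sin (ψ - w.arg) ^ 2 ≤ ‖w - r * Complex.exp (Complex.I * (ψ : ℂ))‖ ^ 2 := by
  have h1 : w - r * Complex.exp (Complex.I * (ψ : ℂ)) =
      (‖w‖ - r * Complex.exp ((ψ - w.arg : ℝ) * Complex.I)) * Complex.exp (w.arg * Complex.I) := by
    rw [sub_mul, Complex.norm_mul_exp_arg_mul_I, mul_assoc, ← Complex.exp_add]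
    congr 3
    push_cast
    ring
  rw [h1, norm_mul, Complex.norm_exp_ofReal_mul_I, mul_one, ← mul_pow, ← sq_abs]
  refine pow_le_pow_left₀ (abs_nonneg _) ?_ 2
  have h2 := Complex.abs_im_le_norm (‖w‖ - r * Complex.exp ((ψ - w.arg : ℝ) * Complex.I))
  rwa [Complex.sub_im, Complex.ofReal_im, Complex.im_ofReal_mul, Complex.exp_ofReal_mul_I_im,
    zero_sub, abs_neg] at h2

/-- The mean over a circle of radius `r` of a Gaussian bump centred at `w`: half of the exponent
pays for the radial distance, and the other half for the angular decay, which yields the factor `1 / r`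
uniformly in `w`. Self-phase modulation only rotates the circle. -/
theorem integral_ringLaw_exp_neg_le {c : ℝ} (hc : 0 < c) {r : ℝ} (hr : 0 < r) (h : ℝ) (w : ℂ) :
    ∫ x, Real.exp (-(c * ‖w - selfPhase h x‖ ^ 2)) ∂(ringLaw r) ≤
      Real.exp (-(c / 2 * (‖w‖ - r) ^ 2)) * (√(Real.pi / (2 * c)) / r) := by
  rw [integral_ringLaw r (by fun_prop)]
  have hpt : ∀ φ : ℝ,
      Real.exp (-(c * ‖w - selfPhase h (r * Complex.exp (Complex.I * (φ : ℂ)))‖ ^ 2)) ≤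
      Real.exp (-(c / 2 * (‖w‖ - r) ^ 2)) *
        Real.exp (-(c / 2 * r ^ 2 * Real.sin (φ + (h * r ^ 2 - w.arg)) ^ 2)) := by
    intro φ
    have hT : selfPhase h (r * Complex.exp (Complex.I * (φ : ℂ))) =
        r * Complex.exp (Complex.I * ((φ + h * r ^ 2 : ℝ) : ℂ)) := by
      rw [selfPhase, norm_mul_exp_I hr.le, mul_assoc, ← Complex.exp_add]
      congr 2
      push_cast
      ring
    rw [hT, ← Real.exp_add, Real.exp_le_exp]
    have h1 := sq_mul_sin_sq_le_sq_norm_sub w r (φ + h * r ^ 2)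
    have h2 : (‖w‖ - r) ^ 2 ≤
        ‖w - r * Complex.exp (Complex.I * ((φ + h * r ^ 2 : ℝ) : ℂ))‖ ^ 2 := by
      have := abs_norm_sub_norm_le w (r * Complex.exp (Complex.I * ((φ + h * r ^ 2 : ℝ) : ℂ)))
      rw [norm_mul_exp_I hr.le] at this
      rw [← sq_abs]
      exact pow_le_pow_left₀ (abs_nonneg _) this 2
    rw [add_sub_assoc] at h1
    nlinarith
  have hint := intervalIntegral.integral_mono_on (μ := volume) Real.two_pi_pos.le
    (Continuous.intervalIntegrable (by unfold selfPhase; fun_prop) _ _)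
    (Continuous.intervalIntegrable (by fun_prop) _ _) fun φ _ => hpt φ
  rw [intervalIntegral.integral_const_mul] at hint
  have hsin := integral_exp_neg_sin_sq_le (b := c / 2 * r ^ 2) (by positivity) (h * r ^ 2 - w.arg)
  have hsqrt : √(Real.pi / (c / 2 * r ^ 2 * (2 / Real.pi) ^ 2)) =
      Real.pi * (√(Real.pi / (2 * c)) / r) := by
    rw [show Real.pi / (c / 2 * r ^ 2 * (2 / Real.pi) ^ 2) =
      Real.pi / (2 * c) * (Real.pi / r) ^ 2 by field_simp,
      Real.sqrt_mul (by positivity), Real.sqrt_sq (by positivity)]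
    ring
  rw [hsqrt] at hsin
  calc _ ≤ (2 * Real.pi)⁻¹ * (Real.exp (-(c / 2 * (‖w‖ - r) ^ 2)) *
        (2 * (Real.pi * (√(Real.pi / (2 * c)) / r)))) := by
        refine mul_le_mul_of_nonneg_left (hint.trans ?_) (by positivity)
        exact mul_le_mul_of_nonneg_left hsin (Real.exp_pos _).le
    _ = _ := by field_simp

/-! ### Multi-ring input laws -/

theorem isProbabilityMeasure_multiRingLaw (p : ℝ) (a : ℕ) {J : ℕ} (hJ : 0 < J) :
    IsProbabilityMeasure (multiRingLaw p a J) := by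
  constructor
  simp only [multiRingLaw, Measure.smul_apply, Measure.coe_finsetSum, Finset.sum_apply,
    measure_univ, Finset.sum_const, Nat.card_Icc, smul_eq_mul, nsmul_eq_mul, mul_one,
    add_tsub_cancel_right]
  exact ENNReal.inv_mul_cancel (by simpa using hJ.ne') (by simp)

theorem ae_multiRingLaw (p : ℝ) (a J : ℕ) :
    ∀ᵐ x ∂(multiRingLaw p a J), ∃ j ∈ Finset.Icc 1 J, ‖x‖ = √((a : ℝ) * (j : ℝ) ^ 2 * p) := by
  refine Measure.ae_smul_measure ?_ _
  rw [ae_finsetSum_measure_iff]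
  intro j hj
  filter_upwards [ae_norm_eq_ringLaw (Real.sqrt_nonneg _)] with x hx using ⟨j, hj, hx⟩

theorem integral_multiRingLaw (p : ℝ) (a J : ℕ) {f : ℂ → ℝ}
    (hf : ∀ r, Integrable f (ringLaw r)) :
    ∫ x, f x ∂(multiRingLaw p a J) =
      (J : ℝ)⁻¹ * ∑ j ∈ Finset.Icc 1 J, ∫ x, f x ∂(ringLaw √((a : ℝ) * (j : ℝ) ^ 2 * p)) := by
  rw [multiRingLaw, integral_smul_measure, integral_finsetSum_measure fun j _ => hf _]
  simp

theorem isInputLaw_multiRingLaw {p : ℝ} (hp : 0 < p) (a : ℕ) {J : ℕ} (hJ : 0 < J) {P : ℝ}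
    (hP : (a : ℝ) * (J : ℝ) ^ 2 * p ≤ P) : IsInputLaw P (multiRingLaw p a J) := by
  have := isProbabilityMeasure_multiRingLaw p a hJ
  have hb : ∀ᵐ x ∂(multiRingLaw p a J), ‖x‖ ^ 2 ≤ P := by
    filter_upwards [ae_multiRingLaw p a J] with x ⟨j, hj, hx⟩
    rw [hx, Real.sq_sqrt (by positivity)]
    refine le_trans ?_ hP
    have : (j : ℝ) ≤ J := by exact_mod_cast (Finset.mem_Icc.1 hj).2
    gcongr
  have hint : Integrable (fun x : ℂ => ‖x‖ ^ 2) (multiRingLaw p a J) := by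
    refine Integrable.of_bound (by fun_prop) P ?_
    filter_upwards [hb] with x hx
    rwa [Real.norm_of_nonneg (by positivity)]
  refine ⟨this, hint, ?_⟩
  have := integral_mono_ae hint (integrable_const P) hb
  simpa using this

theorem ae_sq_norm_multiRingLaw {p : ℝ} (hp : 0 < p) {a : ℕ} (ha : 0 < a) (J : ℕ) :
    ∀ᵐ x ∂(multiRingLaw p a J), ∃ m : ℕ, 0 < m ∧ ‖x‖ ^ 2 = (m : ℝ) * p := by
  filter_upwards [ae_multiRingLaw p a J] with x ⟨j, hj, hx⟩
  refine ⟨a * j ^ 2, Nat.mul_pos ha (pow_pos (Finset.mem_Icc.1 hj).1 2), ?_⟩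
  rw [hx, Real.sq_sqrt (by positivity)]
  push_cast
  ring

theorem summable_exp_neg_mul_int_sq {b : ℝ} (hb : 0 < b) :
    Summable fun k : ℤ => Real.exp (-(b * (k : ℝ) ^ 2)) := by
  have hgeo : Summable fun n : ℕ => Real.exp (-(b * (n : ℝ) ^ 2)) := by
    refine Summable.of_nonneg_of_le (fun _ => (Real.exp_pos _).le) (fun n => ?_)
      (summable_geometric_of_lt_one (Real.exp_pos (-b)).le (by simpa using hb))
    rw [← Real.exp_nat_mul, Real.exp_le_exp]
    have : (n : ℝ) ≤ (n : ℝ) ^ 2 := by exact_mod_cast Nat.le_self_pow two_ne_zero n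
    nlinarith
  refine Summable.of_nat_of_neg (by simpa using hgeo) (by simpa using hgeo)

theorem sum_exp_neg_mul_sub_sq_le {b : ℝ} (hb : 0 < b) (s : Finset ℕ) (j : ℕ) :
    ∑ i ∈ s, Real.exp (-(b * ((i : ℝ) - j) ^ 2)) ≤ ∑' k : ℤ, Real.exp (-(b * (k : ℝ) ^ 2)) := by
  have hinj : Set.InjOn (fun i : ℕ => (i : ℤ) - j) s := by
    intro i _ i' _ h
    simpa using h
  have := (summable_exp_neg_mul_int_sq hb).sum_le_tsum (s.image fun i : ℕ => (i : ℤ) - j)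
    fun _ _ => (Real.exp_pos _).le
  rw [Finset.sum_image hinj] at this
  simpa using this

/-- The collision integral of a multi-ring law. The constant depends neither on the ring spacing
`a ≥ 1`, nor on the number of rings, nor on the self-phase modulation. -/
theorem exists_collision_bound {p c : ℝ} (hp : 0 < p) (hc : 0 < c) :
    ∃ C : ℝ, 0 < C ∧ ∀ (h : ℝ) (a J : ℕ), 0 < a → 0 < J →
      ∫ x', ∫ x, Real.exp (-(c * ‖selfPhase h x' - selfPhase h x‖ ^ 2)) ∂(multiRingLaw p a J)
        ∂(multiRingLaw p a J) ≤ C * (1 + Real.log J) / ((J : ℝ) ^ 2 * √(a * p)) := by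
  set S := ∑' k : ℤ, Real.exp (-(c / 2 * p * (k : ℝ) ^ 2)) with hS
  have hb : 0 < c / 2 * p := by positivity
  have hSpos : 0 < S := (summable_exp_neg_mul_int_sq hb).tsum_pos (fun _ => (Real.exp_pos _).le) 0
    (Real.exp_pos _)
  set K := √(Real.pi / (2 * c)) with hK
  have hKpos : 0 < K := Real.sqrt_pos.2 (by positivity)
  refine ⟨K * S, by positivity, fun h a J ha hJ => ?_⟩
  have := isProbabilityMeasure_multiRingLaw p a hJ
  set μ := multiRingLaw p a J with hμ
  have ha1 : (1 : ℝ) ≤ a := by exact_mod_cast ha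
  set D := √(a * p) with hD
  have hDpos : 0 < D := Real.sqrt_pos.2 (by positivity)
  have hDsq : p ≤ D ^ 2 := by
    rw [hD, Real.sq_sqrt (by positivity)]
    nlinarith
  have hr : ∀ j : ℕ, √((a : ℝ) * (j : ℝ) ^ 2 * p) = j * D := by
    intro j
    rw [show (a : ℝ) * (j : ℝ) ^ 2 * p = (j : ℝ) ^ 2 * (a * p) by ring,
      Real.sqrt_mul (by positivity), Real.sqrt_sq (by positivity)]
  -- `G` bounds the mean over `x` given `x'`; it depends on `‖x'‖` only, so it is constant on rings.
  set G : ℂ → ℝ := fun x' => (J : ℝ)⁻¹ * ∑ j ∈ Finset.Icc 1 J,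
    Real.exp (-(c / 2 * (‖x'‖ - j * D) ^ 2)) * (K / (j * D)) with hG
  have hinner : ∀ x', ∫ x, Real.exp (-(c * ‖selfPhase h x' - selfPhase h x‖ ^ 2)) ∂μ ≤ G x' := by
    intro x'
    rw [hμ, integral_multiRingLaw p a J fun r =>
      integrable_exp_neg (by fun_prop) fun q => by positivity]
    refine mul_le_mul_of_nonneg_left (Finset.sum_le_sum fun j hj => ?_) (by positivity)
    have hj1 : (0 : ℝ) < j := by exact_mod_cast (Finset.mem_Icc.1 hj).1
    rw [hr]
    have := integral_ringLaw_exp_neg_le hc (r := j * D) (by positivity) h (selfPhase h x')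
    rwa [norm_selfPhase] at this
  have hGint : ∀ (ν : Measure ℂ) [IsProbabilityMeasure ν], Integrable G ν := by
    intro ν _
    exact (integrable_finsetSum _ fun j _ =>
      (integrable_exp_neg (by fun_prop) fun q => by positivity).mul_const _).const_mul _
  have hGring : ∀ i : ℕ, ∫ x', G x' ∂(ringLaw (i * D)) =
      (J : ℝ)⁻¹ * ∑ j ∈ Finset.Icc 1 J,
        Real.exp (-(c / 2 * D ^ 2 * ((i : ℝ) - j) ^ 2)) * (K / (j * D)) := by
    intro i
    rw [integral_congr_ae (g := fun _ => (J : ℝ)⁻¹ * ∑ j ∈ Finset.Icc 1 J,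
        Real.exp (-(c / 2 * D ^ 2 * ((i : ℝ) - j) ^ 2)) * (K / (j * D)))]
    · simp
    · filter_upwards [ae_norm_eq_ringLaw (r := i * D) (by positivity)] with x hx
      simp only [hG, hx]
      congr 1
      refine Finset.sum_congr rfl fun j _ => ?_
      congr 3
      ring
  calc ∫ x', ∫ x, Real.exp (-(c * ‖selfPhase h x' - selfPhase h x‖ ^ 2)) ∂μ ∂μ
      ≤ ∫ x', G x' ∂μ := integral_mono_of_nonneg
        (ae_of_all _ fun _ => integral_nonneg fun _ => (Real.exp_pos _).le) (hGint μ)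
        (ae_of_all _ hinner)
    _ = (J : ℝ)⁻¹ * ∑ i ∈ Finset.Icc 1 J, (J : ℝ)⁻¹ * ∑ j ∈ Finset.Icc 1 J,
        Real.exp (-(c / 2 * D ^ 2 * ((i : ℝ) - j) ^ 2)) * (K / (j * D)) := by
        rw [hμ, integral_multiRingLaw p a J fun r => hGint _]
        simp_rw [hr, hGring]
    _ = (J : ℝ)⁻¹ * ((J : ℝ)⁻¹ * ∑ j ∈ Finset.Icc 1 J, (∑ i ∈ Finset.Icc 1 J,
        Real.exp (-(c / 2 * D ^ 2 * ((i : ℝ) - j) ^ 2))) * (K / (j * D))) := by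
        rw [← Finset.mul_sum, Finset.sum_comm]
        simp_rw [Finset.sum_mul]
    _ ≤ (J : ℝ)⁻¹ * ((J : ℝ)⁻¹ * ∑ j ∈ Finset.Icc 1 J, S * (K / (j * D))) := by
        gcongr with j hj
        refine le_trans (Finset.sum_le_sum fun i _ => ?_)
          (sum_exp_neg_mul_sub_sq_le hb (Finset.Icc 1 J) j)
        gcongr
    _ = K * S * (∑ j ∈ Finset.Icc 1 J, (j : ℝ)⁻¹) / ((J : ℝ) ^ 2 * D) := by
        rw [Finset.mul_sum, Finset.mul_sum, Finset.mul_sum, Finset.sum_div]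
        refine Finset.sum_congr rfl fun j hj => ?_
        have hj1 : (0 : ℝ) < j := by exact_mod_cast (Finset.mem_Icc.1 hj).1
        have : (0 : ℝ) < J := by exact_mod_cast hJ
        field_simp
    _ ≤ K * S * (1 + Real.log J) / ((J : ℝ) ^ 2 * D) := by
        gcongr
        have := harmonic_le_one_add_log J
        rw [harmonic_eq_sum_Icc] at this
        push_cast at this
        exact this

/-! ### The number and the spacing of the rings as functions of the power -/

/-- The parameter `a(P)` of the multi-ring law: `⌈N log (P/N)⌉`, but at least `1`, and replaced by
`1` at the powers that are too small for even a single ring with that value. -/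
noncomputable def ringSpacing (N p P : ℝ) : ℕ :=
  if (max 1 ⌈N * Real.log (P / N)⌉₊ : ℕ) * p ≤ P then max 1 ⌈N * Real.log (P / N)⌉₊ else 1

/-- The number `J(P)` of rings: the largest `J` with `a J² p ≤ P`, so that even the outermost ring
respects the power constraint. -/
noncomputable def ringCount (N p P : ℝ) : ℕ :=
  ⌊√(P / (ringSpacing N p P * p))⌋₊

theorem ringSpacing_pos (N p P : ℝ) : 0 < ringSpacing N p P := by
  unfold ringSpacing
  split_ifs
  · exact lt_of_lt_of_le one_pos (le_max_left _ _)
  · exact one_pos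

theorem ringSpacing_mul_le {N p P : ℝ} (hP : p ≤ P) : ringSpacing N p P * p ≤ P := by
  unfold ringSpacing
  split_ifs with h
  · exact h
  · simpa using hP

theorem one_le_sqrt_div {N p P : ℝ} (hp : 0 < p) (hP : p ≤ P) :
    1 ≤ √(P / (ringSpacing N p P * p)) := by
  have : (0 : ℝ) < ringSpacing N p P := by exact_mod_cast ringSpacing_pos N p P
  rw [Real.one_le_sqrt, one_le_div (by positivity)]
  exact ringSpacing_mul_le hP

theorem ringCount_pos {N p P : ℝ} (hp : 0 < p) (hP : p ≤ P) : 0 < ringCount N p P :=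
  Nat.floor_pos.2 (one_le_sqrt_div hp hP)

theorem ringSpacing_mul_ringCount_sq_le {N p P : ℝ} (hp : 0 < p) (hP : p ≤ P) :
    (ringSpacing N p P : ℝ) * (ringCount N p P : ℝ) ^ 2 * p ≤ P := by
  have ha : (0 : ℝ) < ringSpacing N p P := by exact_mod_cast ringSpacing_pos N p P
  have h1 : (ringCount N p P : ℝ) ^ 2 ≤ √(P / (ringSpacing N p P * p)) ^ 2 :=
    pow_le_pow_left₀ (by positivity) (Nat.floor_le (Real.sqrt_nonneg _)) 2
  rw [Real.sq_sqrt (div_nonneg (hp.le.trans hP) (by positivity)), le_div_iff₀ (by positivity)] at h1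
  linarith

theorem le_four_mul_ringCount_sq {N p P : ℝ} (hp : 0 < p) (hP : p ≤ P) :
    P ≤ 4 * ((ringCount N p P : ℝ) ^ 2 * (ringSpacing N p P * p)) := by
  have ha : (0 : ℝ) < ringSpacing N p P := by exact_mod_cast ringSpacing_pos N p P
  have h0 : (1 : ℝ) ≤ ringCount N p P := by exact_mod_cast ringCount_pos (N := N) hp hP
  have h1 : √(P / (ringSpacing N p P * p)) ≤ 2 * ringCount N p P := by
    have : √(P / (ringSpacing N p P * p)) < ringCount N p P + 1 := Nat.lt_floor_add_one _
    linarith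
  have h2 := pow_le_pow_left₀ (Real.sqrt_nonneg _) h1 2
  rw [Real.sq_sqrt (div_nonneg (hp.le.trans hP) (by positivity)), div_le_iff₀ (by positivity)] at h2
  linarith

/-- The multi-ring law with the spacing and the number of rings chosen for the power `P`. -/
noncomputable def multiRingScheme (N p P : ℝ) : Measure ℂ :=
  multiRingLaw p (ringSpacing N p P) (ringCount N p P)

theorem isInputLaw_multiRingScheme {N p P : ℝ} (hp : 0 < p) (hP : p ≤ P) :
    IsInputLaw P (multiRingScheme N p P) :=
  isInputLaw_multiRingLaw hp _ (ringCount_pos hp hP) (ringSpacing_mul_ringCount_sq_le hp hP)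

theorem tendsto_log_div_atTop {N : ℝ} (hN : 0 < N) :
    Tendsto (fun P => Real.log (P / N)) atTop atTop :=
  Real.tendsto_log_atTop.comp (tendsto_id.atTop_div_const hN)

/-- The power constraint does not interfere with the choice `a = ⌈N log (P/N)⌉` at high power. -/
theorem eventually_ringSpacing_eq {N p : ℝ} (hN : 0 < N) (hp : 0 < p) :
    ∀ᶠ P in atTop, ringSpacing N p P = ⌈N * Real.log (P / N)⌉₊ := by
  have hlog := tendsto_log_div_atTop hN
  have h1 : ∀ᶠ t : ℝ in atTop, (N * t + 1) * p / N ≤ Real.exp t := by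
    have : Tendsto (fun t : ℝ => Real.exp t / t) atTop atTop := by
      simpa using Real.tendsto_exp_div_pow_atTop 1
    filter_upwards [this.eventually_ge_atTop ((N + 1) * p / N), eventually_ge_atTop 1] with t ht ht1
    rw [le_div_iff₀ (by linarith)] at ht
    refine le_trans ?_ ht
    rw [div_mul_eq_mul_div]
    gcongr ?_ / N
    rw [mul_right_comm]
    gcongr
    nlinarith
  filter_upwards [hlog.eventually h1, hlog.eventually_gt_atTop 0, eventually_gt_atTop 0]
    with P hP hpos hP0
  have hx : 0 < N * Real.log (P / N) := by positivity
  have hmax : max 1 ⌈N * Real.log (P / N)⌉₊ = ⌈N * Real.log (P / N)⌉₊ :=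
    max_eq_right (Nat.one_le_ceil_iff.2 hx)
  rw [ringSpacing, hmax, if_pos]
  rw [Real.exp_log (by positivity), div_le_div_iff_of_pos_right hN] at hP
  refine le_trans ?_ hP
  gcongr
  exact (Nat.ceil_lt_add_one hx.le).le

theorem isEquivalent_ringSpacing {N p : ℝ} (hN : 0 < N) (hp : 0 < p) :
    Asymptotics.IsEquivalent atTop (fun P => (ringSpacing N p P : ℝ))
      (fun P => N * Real.log (P / N)) := by
  have h1 : Asymptotics.IsEquivalent atTop (fun x : ℝ => (⌈x⌉₊ : ℝ)) id :=
    Asymptotics.isEquivalent_of_tendsto_one tendsto_nat_ceil_div_atTop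
  have h2 := h1.comp_tendsto ((tendsto_log_div_atTop hN).const_mul_atTop hN)
  refine h2.congr_left ?_
  filter_upwards [eventually_ringSpacing_eq hN hp] with P hP
  simp [hP]

theorem channelInfo_multiRingScheme_le {N p P : ℝ} (hN : 0 < N) (hp : 0 < p) (hP : p ≤ P) (h : ℝ) :
    channelInfo N (multiRingScheme N p P) (selfPhase h) ≤
      ENNReal.ofReal (Real.log ((P + N) / N) + 2) := by
  have := isProbabilityMeasure_multiRingLaw p (ringSpacing N p P) (ringCount_pos (N := N) hp hP)
  exact channelInfo_le (μ := multiRingLaw _ _ _) hN (by fun_prop) (norm_selfPhase h)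
    (isInputLaw_multiRingScheme hp hP)

theorem channelInfo_multiRingScheme_ne_top {N p P : ℝ} (hN : 0 < N) (hp : 0 < p) (hP : p ≤ P)
    (h : ℝ) : channelInfo N (multiRingScheme N p P) (selfPhase h) ≠ ∞ :=
  ne_top_of_le_ne_top ENNReal.ofReal_ne_top (channelInfo_multiRingScheme_le hN hp hP h)

/-- The lower bound at power `P`: the subtracted terms other than `C` are `O(log log P)`, since the
spacing grows like `log P`. -/
theorem exists_le_channelInfo_multiRingScheme {N p : ℝ} (hN : 0 < N) (hp : 0 < p) (h : ℝ) :
    ∃ C : ℝ, ∀ P, p ≤ P → Real.log P - Real.log (1 + Real.log (P / p)) -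
      Real.log (ringSpacing N p P * p) / 2 - C ≤
        (channelInfo N (multiRingScheme N p P) (selfPhase h)).toReal := by
  obtain ⟨C, hC, hcol⟩ := exists_collision_bound hp (c := (4 * N)⁻¹) (by positivity)
  refine ⟨1 / 2 + Real.log (8 * C), fun P hP => ?_⟩
  have hP0 : 0 < P := hp.trans_le hP
  have hJ := ringCount_pos (N := N) hp hP
  have ha := ringSpacing_pos N p P
  have hJ1 : (1 : ℝ) ≤ ringCount N p P := by exact_mod_cast hJ
  have ha1 : (1 : ℝ) ≤ ringSpacing N p P := by exact_mod_cast ha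
  have hpow := ringSpacing_mul_ringCount_sq_le (N := N) hp hP
  have hfour := le_four_mul_ringCount_sq (N := N) hp hP
  have hb := hcol h _ _ ha hJ
  have := isProbabilityMeasure_multiRingLaw p (ringSpacing N p P) hJ
  have hfin := channelInfo_multiRingScheme_ne_top hN hp hP h
  rw [multiRingScheme] at hfin ⊢
  set J := ringCount N p P
  set a := ringSpacing N p P
  have hap : 0 < (a : ℝ) * p := by positivity
  have hL : 0 ≤ Real.log (P / p) := Real.log_nonneg ((one_le_div hp).2 hP)
  have hlogJ : Real.log J ≤ Real.log (P / p) := by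
    refine Real.log_le_log (by positivity) ((le_div_iff₀ hp).2 (le_trans ?_ hpow))
    have : (J : ℝ) ≤ a * (J : ℝ) ^ 2 := by nlinarith
    gcongr
  have hB : C * (1 + Real.log J) / ((J : ℝ) ^ 2 * √(a * p)) ≤
      4 * C * (1 + Real.log (P / p)) * √(a * p) / P := by
    rw [div_le_div_iff₀ (by positivity) hP0]
    calc C * (1 + Real.log J) * P
        ≤ C * (1 + Real.log (P / p)) * (4 * ((J : ℝ) ^ 2 * (a * p))) := by gcongr
      _ = C * (1 + Real.log (P / p)) * (4 * ((J : ℝ) ^ 2 * (√(a * p) * √(a * p)))) := by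
        rw [Real.mul_self_sqrt hap.le]
      _ = 4 * C * (1 + Real.log (P / p)) * √(a * p) * ((J : ℝ) ^ 2 * √(a * p)) := by ring
  simp only [inv_mul_eq_div] at hb
  have hmain := le_channelInfo hN (by fun_prop) hfin (hb.trans hB)
  refine le_trans (le_of_eq ?_) hmain
  rw [show 2 * (4 * C * (1 + Real.log (P / p)) * √(a * p) / P) =
    8 * C * (1 + Real.log (P / p)) * √(a * p) / P by ring,
    Real.log_div (by positivity) hP0.ne',
    Real.log_mul (x := 8 * C * (1 + Real.log (P / p))) (by positivity) (by positivity),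
    Real.log_mul (x := 8 * C) (by positivity) (by positivity), Real.log_sqrt hap.le]
  ring

theorem tendsto_channelInfo_multiRingScheme {N p : ℝ} (hN : 0 < N) (hp : 0 < p) (h : ℝ) :
    Tendsto (fun P => (channelInfo N (multiRingScheme N p P) (selfPhase h)).toReal /
      Real.log (P / N)) atTop (𝓝 1) := by
  have hlog := tendsto_log_div_atTop hN
  obtain ⟨C, hC⟩ := exists_le_channelInfo_multiRingScheme hN hp h
  have hlogdiv : Tendsto (fun t : ℝ => Real.log t / t) atTop (𝓝 0) := by
    simpa using Real.tendsto_pow_log_div_mul_add_atTop 1 0 1 one_ne_zero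
  have hconst : ∀ c : ℝ, Tendsto (fun t : ℝ => c / t) atTop (𝓝 0) := fun c =>
    tendsto_const_nhds.div_atTop tendsto_id
  have hlow : Tendsto (fun t : ℝ => 1 - 3 * (Real.log t / t) + (Real.log N - C) / t) atTop
      (𝓝 1) := by
    simpa using (tendsto_const_nhds (x := (1 : ℝ))).sub (hlogdiv.const_mul 3) |>.add
      (hconst (Real.log N - C))
  have hup : Tendsto (fun t : ℝ => 1 + (Real.log 2 + 2) / t) atTop (𝓝 1) := by
    simpa using (tendsto_const_nhds (x := (1 : ℝ))).add (hconst (Real.log 2 + 2))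
  have hquad : ∀ b c : ℝ, ∀ᶠ t : ℝ in atTop, b * t + c ≤ t ^ 2 := by
    intro b c
    filter_upwards [eventually_ge_atTop (|b| + |c| + 1)] with t ht
    nlinarith [le_abs_self b, le_abs_self c, abs_nonneg b, abs_nonneg c]
  -- In terms of `t = log (P/N)`, the information lies between `t - 3 log t + log N - C` and
  -- `t + log 2 + 2`.
  refine tendsto_of_tendsto_of_tendsto_of_le_of_le' (hlow.comp hlog) (hup.comp hlog) ?_ ?_
  · filter_upwards [eventually_ge_atTop p, eventually_ringSpacing_eq hN hp,
      hlog.eventually_gt_atTop 0, hlog.eventually (hquad 1 (1 + Real.log (N / p))),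
      hlog.eventually (hquad (N * p) p)] with P hP ha ht hq1 hq2
    have hP0 : 0 < P := hp.trans_le hP
    have hCP := hC P hP
    set t := Real.log (P / N) with ht_def
    have hlogP : Real.log P = t + Real.log N := by
      rw [ht_def, Real.log_div hP0.ne' hN.ne']; ring
    have hL : Real.log (P / p) = t + Real.log (N / p) := by
      rw [Real.log_div hP0.ne' hp.ne', Real.log_div hN.ne' hp.ne', hlogP]; ring
    have hLnn : 0 ≤ Real.log (P / p) := Real.log_nonneg ((one_le_div hp).2 hP)
    have hsq : Real.log (t ^ 2) = 2 * Real.log t := by simp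
    have h1 : Real.log (1 + Real.log (P / p)) ≤ 2 * Real.log t := by
      rw [← hsq]
      exact Real.log_le_log (by positivity) (by linarith)
    have h2 : Real.log (ringSpacing N p P * p) ≤ 2 * Real.log t := by
      have ha0 : (0 : ℝ) < ringSpacing N p P := by exact_mod_cast ringSpacing_pos N p P
      rw [← hsq]
      refine Real.log_le_log (by positivity) (le_trans ?_ hq2)
      rw [ha]
      have := (Nat.ceil_lt_add_one (a := N * t) (by positivity)).le
      calc (⌈N * t⌉₊ : ℝ) * p ≤ (N * t + 1) * p := by gcongr
        _ = N * p * t + p := by ring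
    simp only [Function.comp, ← ht_def]
    rw [le_div_iff₀ ht]
    have h3 : (1 - 3 * (Real.log t / t) + (Real.log N - C) / t) * t =
        t - 3 * Real.log t + (Real.log N - C) := by field_simp
    linarith
  · filter_upwards [eventually_ge_atTop p, eventually_ge_atTop N, hlog.eventually_gt_atTop 0]
      with P hP hPN ht
    have hP0 : 0 < P := hp.trans_le hP
    have hle := channelInfo_multiRingScheme_le hN hp hP h
    have hnn : 0 ≤ Real.log ((P + N) / N) :=
      Real.log_nonneg ((one_le_div hN).2 (by linarith))
    have h1 := ENNReal.toReal_le_of_le_ofReal (by linarith) hle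
    have h2 : Real.log ((P + N) / N) ≤ Real.log 2 + Real.log (P / N) := by
      rw [← Real.log_mul two_ne_zero (by positivity)]
      refine Real.log_le_log (by positivity) ?_
      rw [← mul_div_assoc]
      gcongr
      linarith
    simp only [Function.comp]
    rw [div_le_iff₀ ht, add_mul, div_mul_cancel₀ _ ht.ne']
    linarith

theorem isInterferenceFocused_multiRingScheme {h : Matrix (Fin 2) (Fin 2) ℝ} {k l : Fin 2}
    (hkl : k ≠ l) (hh : h k l ≠ 0) (N P : ℝ) :
    IsInterferenceFocused h l (multiRingScheme N (2 * Real.pi / |h k l|) P) := by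
  intro k' hk'
  obtain rfl : k' = k := by omega
  filter_upwards [ae_sq_norm_multiRingLaw (by positivity) (ringSpacing_pos N _ P) _]
    with x ⟨m, hm, hx⟩
  rw [hx]
  rcases lt_or_gt_of_ne hh with hneg | hpos
  · refine ⟨-m, by omega, ?_⟩
    rw [abs_of_neg hneg]
    push_cast
    field_simp
  · refine ⟨m, by omega, ?_⟩
    rw [abs_of_pos hpos]
    push_cast
    field_simp

end Fiber

theorem theorem2 (N : ℝ) (hN : 0 < N) :
    (∀ p : ℝ, 0 < p →
      ∃ (a J : ℝ → ℕ) (μ : ℝ → Measure ℂ),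
        (∀ P : ℝ, p ≤ P →
          0 < a P ∧ 0 < J P ∧ μ P = Fiber.multiRingLaw p (a P) (J P) ∧
          Fiber.IsInputLaw P (μ P) ∧
          (∀ᵐ x ∂(μ P), ∃ m : ℕ, 0 < m ∧ ‖x‖ ^ 2 = (m : ℝ) * p) ∧
          Fiber.awgnInfo N (μ P) ≠ ∞) ∧
        Asymptotics.IsEquivalent atTop (fun P => (a P : ℝ)) (fun P => N * Real.log (P / N)) ∧
        ∃ L : ℝ, 1 ≤ L ∧
          Tendsto (fun P => (Fiber.awgnInfo N (μ P)).toReal / Real.log (P / N)) atTop (𝓝 L)) ∧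
    (∀ h : Matrix (Fin 2) (Fin 2) ℝ, h 0 1 ≠ 0 → h 1 0 ≠ 0 →
      ∃ μ : ℝ → Fin 2 → Measure ℂ,
        (∀ P k l, k ≠ l → 2 * Real.pi / |h k l| ≤ P →
          Fiber.IsInputLaw P (μ P l) ∧ Fiber.IsInterferenceFocused h l (μ P l)) ∧
        Fiber.AchievesHighPowerPreLog h N μ (fun _ => 1)) := by
  refine ⟨fun p hp => ⟨Fiber.ringSpacing N p, Fiber.ringCount N p, Fiber.multiRingScheme N p,
    fun P hP => ⟨Fiber.ringSpacing_pos N p P, Fiber.ringCount_pos hp hP, rfl,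
      Fiber.isInputLaw_multiRingScheme hp hP,
      Fiber.ae_sq_norm_multiRingLaw hp (Fiber.ringSpacing_pos N p P) _, ?_⟩,
    Fiber.isEquivalent_ringSpacing hN hp, 1, le_rfl, ?_⟩, fun h h01 h10 => ?_⟩
  · rw [Fiber.awgnInfo_eq_channelInfo]
    exact Fiber.channelInfo_multiRingScheme_ne_top hN hp hP 0
  · simp_rw [Fiber.awgnInfo_eq_channelInfo]
    exact Fiber.tendsto_channelInfo_multiRingScheme hN hp 0
  have hh : ∀ k l : Fin 2, k ≠ l → h k l ≠ 0 := by
    intro k l hkl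
    fin_cases k <;> fin_cases l <;> simp_all
  -- On `Fin 2`, the user other than `l` is `l + 1`.
  set q : Fin 2 → ℝ := fun l => 2 * Real.pi / |h (l + 1) l| with hq
  have hkl' : ∀ k l : Fin 2, k ≠ l → k = l + 1 := by decide
  have hne : ∀ l : Fin 2, l + 1 ≠ l := by decide
  have hqpos : ∀ l, 0 < q l := fun l => div_pos Real.two_pi_pos (abs_pos.2 (hh _ _ (hne l)))
  have hfoc : ∀ P l, Fiber.IsInterferenceFocused h l (Fiber.multiRingScheme N (q l) P) :=
    fun P l => Fiber.isInterferenceFocused_multiRingScheme (hne l) (hh _ _ (hne l)) N P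
  have hrate : ∀ k, ∀ᶠ P in atTop,
      Fiber.xpmRate h N (fun l => Fiber.multiRingScheme N (q l) P) k =
        Fiber.channelInfo N (Fiber.multiRingScheme N (q k) P) (Fiber.selfPhase (h k k)) := by
    intro k
    filter_upwards [eventually_ge_atTop (q 0), eventually_ge_atTop (q 1)] with P h0 h1
    have hP : ∀ l, q l ≤ P := Fin.forall_fin_two.2 ⟨h0, h1⟩
    have : ∀ l, IsProbabilityMeasure (Fiber.multiRingScheme N (q l) P) := fun l =>
      (Fiber.isInputLaw_multiRingScheme (hqpos l) (hP l)).isProbabilityMeasure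
    exact Fiber.xpmRate_eq_channelInfo h N _ (hne k).symm (hfoc P (k + 1))
  refine ⟨fun P l => Fiber.multiRingScheme N (q l) P, fun P k l hkl hP => ?_, fun k => ⟨?_, ?_⟩⟩
  · obtain rfl := hkl' k l hkl
    exact ⟨Fiber.isInputLaw_multiRingScheme (hqpos l) hP, hfoc P l⟩
  · filter_upwards [hrate k, eventually_ge_atTop (q k)] with P hP hPk
    rw [hP]
    exact ⟨Fiber.isInputLaw_multiRingScheme (hqpos k) hPk,
      Fiber.channelInfo_multiRingScheme_ne_top hN (hqpos k) hPk _⟩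
  · refine (Fiber.tendsto_channelInfo_multiRingScheme hN (hqpos k) (h k k)).congr' ?_
    filter_upwards [hrate k] with P hP
    rw [hP]
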